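/- Let $\mathbb K$ be a field, let $n\ge 3$ be an odd integer and let $r\ge 1$. Define graphs inductively: $G_0^n$ is a cycle of length $n$, and $G_{s}^n$ is obtained from $G_{s-1}^n$ by attaching to each vertex that has degree two in $G_{s-1}^n$ its own new cycle of length $n$ (one vertex of the new cycle is identified with that vertex). For a finite simple graph $G$ let $I_G\subseteq\mathbb K[e : e\in E(G)]$ be its toric ideal, i.e. the ideal generated by all binomials $x^u-x^v$ with $\sum_e u_e a_e=\sum_e v_e a_e$, where $a_{\{i,j\}}=i+j$ in the free abelian group on $V(G)$. A nonzero binomial $x^u-x^v\in I_G$ is primitive if there is no other nonzero binomial $x^w-x^z\in I_G$ with $x^w\mid x^u$ and $x^z\mid x^v$; the set of primitive binomials is the Graver basis of $I_G$. For an even closed walk $w=(e_{i_1},\dots,e_{i_{2q}})$ put $B_w=\prod_{k=1}^q e_{i_{2k-1}}-\prod_{k=1}^q e_{i_{2k}}$. Let $w$ be any closed Eulerian trail of $G_r^n$ (a closed walk that traverses every edge exactly once). Then $w$ has even length, the binomial $B_{w}$ is primitive, so it lies in the Graver basis of $I_{G_r^n}$, and $$\deg(B_{w})=\frac12\left(n+n^2\,\frac{(n-1)^r-1}{n-2}\right).$$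 -/

import Mathlib

/-! ### Toric ideals, primitive binomials and the Graver basis -/

/-- The `A`-degree `u₁ a₁ + ⋯ + u_m a_m` of the monomial `x^u`. -/
def toricDegree {σ M : Type*} [AddCommMonoid M] (a : σ → M) (u : σ →₀ ℕ) : M :=
  u.sum fun i k => k • a i

/-- The monomial `x^u`. -/
noncomputable abbrev monom (K : Type*) [Field K] {σ : Type*} (u : σ →₀ ℕ) : MvPolynomial σ K :=
  MvPolynomial.monomial u 1

/-- The toric ideal of the configuration `a`: the ideal generated by all binomials `x^u - x^v`
with `deg_A x^u = deg_A x^v`. -/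
noncomputable def toricIdeal (K : Type*) [Field K] {σ M : Type*} [AddCommMonoid M] (a : σ → M) :
    Ideal (MvPolynomial σ K) :=
  Ideal.span {p | ∃ u v : σ →₀ ℕ, toricDegree a u = toricDegree a v ∧ p = monom K u - monom K v}

/-- `p` is a primitive binomial of the ideal `I`: it is a nonzero binomial `x^u - x^v` of `I`, and
there is no other nonzero binomial `x^w - x^z` of `I` with `x^w ∣ x^u` and `x^z ∣ x^v`. -/
def IsPrimitiveBinomial {K : Type*} [Field K] {σ : Type*} (I : Ideal (MvPolynomial σ K))
    (p : MvPolynomial σ K) : Prop :=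
  ∃ u v : σ →₀ ℕ, p = monom K u - monom K v ∧ p ≠ 0 ∧ p ∈ I ∧
    ∀ w z : σ →₀ ℕ, monom K w - monom K z ∈ I → monom K w - monom K z ≠ 0 →
      monom K w ∣ monom K u → monom K z ∣ monom K v → monom K w - monom K z = p

/-- The Graver basis of the toric ideal of `a`: the set of its primitive binomials. -/
def graverBasis (K : Type*) [Field K] {σ M : Type*} [AddCommMonoid M] (a : σ → M) :
    Set (MvPolynomial σ K) :=
  {p | IsPrimitiveBinomial (toricIdeal K a) p}

/-! ### Toric ideals of graphs -/

namespace SimpleGraph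

variable {V : Type*} (G : SimpleGraph V)

/-- The vector `a_e = v + v'` of an edge `e = {v, v'}`, in the free abelian group on the
vertices. -/
noncomputable def edgeVector (e : G.edgeSet) : V →₀ ℤ :=
  Sym2.lift ⟨fun v v' => Finsupp.single v 1 + Finsupp.single v' 1, fun _ _ => add_comm _ _⟩ e.1

variable {G}

/-- The edge of a walk at position `i`, counted from `0`. -/
def Walk.edgeAt {v v' : V} (w : G.Walk v v') (i : ℕ) (hi : i < w.length) : G.edgeSet :=
  ⟨s(w.getVert i, w.getVert (i + 1)), w.adj_getVert_succ hi⟩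

/-- `E⁺(w)`, the product of the edges `e₁, e₃, …, e_{2q-1}` of a walk `w = (e₁, …, e_{2q})`
(the positions `0, 2, …, 2q - 2` when counted from `0`). -/
noncomputable def Walk.evenWalkPos (K : Type*) [Field K] {v v' : V} (w : G.Walk v v') :
    MvPolynomial G.edgeSet K :=
  ∏ k : Fin (w.length / 2), MvPolynomial.X (w.edgeAt (2 * k) (by omega))

/-- `E⁻(w)`, the product of the edges `e₂, e₄, …, e_{2q}` of a walk `w = (e₁, …, e_{2q})`. -/
noncomputable def Walk.evenWalkNeg (K : Type*) [Field K] {v v' : V} (w : G.Walk v v') :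
    MvPolynomial G.edgeSet K :=
  ∏ k : Fin (w.length / 2), MvPolynomial.X (w.edgeAt (2 * k + 1) (by omega))

/-- The binomial `B_w = E⁺(w) - E⁻(w)` of a closed walk `w`; it is meaningful only if the length
of `w` is even. -/
noncomputable def Walk.binomial (K : Type*) [Field K] {v : V} (w : G.Walk v v) :
    MvPolynomial G.edgeSet K :=
  w.evenWalkPos K - w.evenWalkNeg K

/-! ### Iterated attachment of cycles -/

variable (G)

/-- The graph obtained from `G` by adding to each vertex `s ∈ S` its own new cycle of length `n`,
whose vertex `0` is identified with `s`. The vertices are those of `G` and, for each `s ∈ S`, the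
nonzero vertices of the cycle attached at `s`. -/
def addCycles (S : Set V) (n : ℕ) : SimpleGraph (V ⊕ S × {i : Fin n // i.val ≠ 0}) where
  Adj
    | .inl a, .inl b => G.Adj a b
    | .inl a, .inr (s, i) => a = s ∧ (cycleGraph n).Adj ⟨0, i.1.pos⟩ i
    | .inr (s, i), .inl a => a = s ∧ (cycleGraph n).Adj ⟨0, i.1.pos⟩ i
    | .inr (s, i), .inr (t, j) => s = t ∧ (cycleGraph n).Adj i j
  symm := ⟨by
    rintro (a | ⟨s, i⟩) (b | ⟨t, j⟩) h
    · exact G.adj_symm h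
    · exact h
    · exact h
    · exact ⟨h.1.symm, (cycleGraph n).adj_symm h.2⟩⟩
  loopless := ⟨by
    rintro (a | ⟨s, i⟩) h
    · exact G.loopless.irrefl _ h
    · exact (cycleGraph n).loopless.irrefl _ h.2⟩

/-- The iterated graph together with its vertex type: at stage `0` the cycle of length `n`; at
stage `r + 1` a cycle of length `n` is added to each vertex of degree two of stage `r`. -/
def cycleTower (n : ℕ) : ℕ → Σ V : Type, SimpleGraph V
  | 0 => ⟨Fin n, cycleGraph n⟩
  | r + 1 => ⟨_, (cycleTower n r).2.addCycles
      {v | ((cycleTower n r).2.neighborSet v).ncard = 2} n⟩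

/-- The vertex set of `G_r^n`. -/
abbrev IterVertex (n r : ℕ) : Type := (cycleTower n r).1

/-- The graph `G_r^n`. -/
abbrev iterGraph (n r : ℕ) : SimpleGraph (IterVertex n r) := (cycleTower n r).2

end SimpleGraph

/-! Give the edges of the trail alternating signs `ε = ±1`. Since the trail is closed, of even
length and uses each edge once, `ε` sums to zero at every vertex. A binomial `x^p - x^q` of the
ideal dividing `B_w` termwise amounts to a 0/1 function `σ` on the edges for which `σ * ε` also sums
to zero at every vertex. If such a `σ` is constant at each vertex, it is constant along the trail,
hence everywhere: value 0 gives the zero binomial, value 1 gives `B_w`. This reduction is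
`Walk.IsEulerian.isPrimitiveBinomial`.

Local constancy of `σ` is proved by `isConstAt_iterGraph`, removing the outermost cycles stage by
stage. Such a cycle has an even number of vertices besides its attaching vertex `s`. So whether `ε`
alternates along it or is constant, its two edges at `s` carry equal signs, and equal values of `σ`.
Balance at `s`, of degree four, gives the two old edges the opposite sign and the same `σ`. In the
smaller graph `ε` and `σ` are thus constant at vertices of degree two, and the argument repeats.

The degree is half the number of edges, which is counted by the handshake lemma and a geometric sum.
-/

namespace SimpleGraph

/-- The values of `g` on the edges at `v` sum to zero. -/
def IsBalancedAt {V : Type*} (G : SimpleGraph V) (g : Sym2 V → ℤ) (v : V) : Prop :=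
  ∑ᶠ a ∈ G.neighborSet v, g s(v, a) = 0

/-- All edges at `v` have the same value under `g`. -/
def IsConstAt {V : Type*} (G : SimpleGraph V) (g : Sym2 V → ℤ) (v : V) : Prop :=
  ∀ a ∈ G.neighborSet v, ∀ b ∈ G.neighborSet v, g s(v, a) = g s(v, b)

/-- The vertex `i` of the cycle attached at `s`. -/
def cycleVertex {V : Type*} {S : Set V} {m : ℕ} (s : S) (i : Fin (m + 3)) :
    V ⊕ S × {i : Fin (m + 3) // i.val ≠ 0} :=
  if h : i.val ≠ 0 then .inr (s, ⟨i, h⟩) else .inl s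

/-! ### Neighbourhoods and degrees after attaching cycles. -/

section addCycles

variable {V : Type*} {G : SimpleGraph V} {S : Set V} {m : ℕ}

@[simp] theorem cycleVertex_zero (s : S) :
    cycleVertex s (0 : Fin (m + 3)) = .inl (s : V) := by
  simp [cycleVertex]

theorem cycleVertex_of_ne (s : S) (i : {i : Fin (m + 3) // i.val ≠ 0}) :
    cycleVertex s i.1 = .inr (s, i) := by
  simp [cycleVertex, i.2]

theorem cycleVertex_injective (s : S) :
    Function.Injective (cycleVertex (m := m) s) := by
  intro i j h
  unfold cycleVertex at h
  split_ifs at h with hi hj hj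
  · simpa using h
  · apply Fin.ext
    omega

/-- Length at least three keeps the two neighbours of a cycle vertex distinct. -/
theorem one_ne_neg_one_fin : (1 : Fin (m + 3)) ≠ -1 := by
  intro h
  have := congrArg Fin.val h
  simp [Fin.val_neg] at this

theorem sub_one_ne_add_one (i : Fin (m + 3)) : i - 1 ≠ i + 1 := by
  intro h
  rw [sub_eq_add_neg] at h
  exact one_ne_neg_one_fin (add_left_cancel h).symm

theorem neighborSet_addCycles_inr (s : S) (i : {i : Fin (m + 3) // i.val ≠ 0}) :
    (G.addCycles S (m + 3)).neighborSet (.inr (s, i)) =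
      {cycleVertex s (i.1 - 1), cycleVertex s (i.1 + 1)} := by
  have key : ∀ j : Fin (m + 3), (j = i.1 - 1 ∨ j = i.1 + 1) ↔ (cycleGraph (m + 3)).Adj i.1 j := by
    intro j
    have := Set.ext_iff.1 (cycleGraph_neighborSet (n := m + 1) (v := i.1)) j
    simpa using this.symm
  ext (a | ⟨t, j⟩)
  · simp only [mem_neighborSet, Set.mem_insert_iff, Set.mem_singleton_iff]
    by_cases ha : a = s
    · subst ha
      rw [← cycleVertex_zero (m := m) s, (cycleVertex_injective s).eq_iff,
        (cycleVertex_injective s).eq_iff, key, cycleVertex_zero]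
      change (_ = _ ∧ (cycleGraph (m + 3)).Adj 0 i.1) ↔ _
      simp [adj_comm]
    · constructor
      · rintro ⟨h, -⟩
        exact absurd h ha
      · intro h
        unfold cycleVertex at h
        split_ifs at h <;> simp_all
  · simp only [mem_neighborSet, Set.mem_insert_iff, Set.mem_singleton_iff]
    by_cases ht : t = s
    · subst ht
      rw [← cycleVertex_of_ne t j, (cycleVertex_injective t).eq_iff,
        (cycleVertex_injective t).eq_iff, key, cycleVertex_of_ne]
      change (_ = _ ∧ _) ↔ _
      simp
    · constructor
      · rintro ⟨h, -⟩
        exact absurd h.symm ht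
      · intro h
        unfold cycleVertex at h
        split_ifs at h <;> simp_all

theorem neighborSet_addCycles_inl_of_mem (s : S) :
    (G.addCycles S (m + 3)).neighborSet (.inl s) =
      Sum.inl '' G.neighborSet s ∪ {cycleVertex s (-1), cycleVertex s 1} := by
  have key : ∀ j : Fin (m + 3), (j = -1 ∨ j = 1) ↔ (cycleGraph (m + 3)).Adj 0 j := by
    intro j
    have := Set.ext_iff.1 (cycleGraph_neighborSet (n := m + 1) (v := 0)) j
    simpa using this.symm
  ext (a | ⟨t, j⟩)
  · simp only [mem_neighborSet, Set.mem_union, Set.mem_image, Sum.inl.injEq, exists_eq_right,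
      Set.mem_insert_iff, Set.mem_singleton_iff]
    change G.Adj s a ↔ _
    simp [cycleVertex]
  · simp only [mem_neighborSet, Set.mem_union, Set.mem_image, reduceCtorEq, and_false,
      exists_false, false_or, Set.mem_insert_iff, Set.mem_singleton_iff]
    by_cases ht : t = s
    · subst ht
      rw [← cycleVertex_of_ne t j, (cycleVertex_injective t).eq_iff,
        (cycleVertex_injective t).eq_iff, key, cycleVertex_of_ne]
      change (_ = _ ∧ (cycleGraph (m + 3)).Adj 0 j.1) ↔ _
      simp
    · constructor
      · rintro ⟨h, -⟩
        exact absurd (Subtype.ext h).symm ht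
      · intro h
        unfold cycleVertex at h
        split_ifs at h <;> simp_all

theorem neighborSet_addCycles_inl_of_notMem {v : V} (hv : v ∉ S) :
    (G.addCycles S (m + 3)).neighborSet (.inl v) = Sum.inl '' G.neighborSet v := by
  ext (a | ⟨t, j⟩)
  · simp only [mem_neighborSet, Set.mem_image, Sum.inl.injEq, exists_eq_right]
    exact Iff.rfl
  · simp only [mem_neighborSet, Set.mem_image, reduceCtorEq, and_false, exists_false, iff_false]
    rintro ⟨h, -⟩
    exact hv (h ▸ t.2)

theorem disjoint_image_inl_cycleVertex (s : S) (N : Set V) :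
    Disjoint (Sum.inl '' N)
      ({cycleVertex s (-1), cycleVertex s (1 : Fin (m + 3))} :
        Set (V ⊕ S × {i : Fin (m + 3) // i.val ≠ 0})) := by
  rw [Set.disjoint_left]
  rintro _ ⟨a, -, rfl⟩
  simp [cycleVertex]

theorem ncard_neighborSet_addCycles_inr (s : S) (i : {i : Fin (m + 3) // i.val ≠ 0}) :
    ((G.addCycles S (m + 3)).neighborSet (.inr (s, i))).ncard = 2 := by
  rw [neighborSet_addCycles_inr]
  exact Set.ncard_pair fun h => sub_one_ne_add_one _ (cycleVertex_injective s h)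

theorem ncard_neighborSet_addCycles_inl_of_notMem {v : V} (hv : v ∉ S) :
    ((G.addCycles S (m + 3)).neighborSet (.inl v)).ncard = (G.neighborSet v).ncard := by
  rw [neighborSet_addCycles_inl_of_notMem hv, Set.ncard_image_of_injective _ Sum.inl_injective]

theorem ncard_neighborSet_addCycles_inl_of_mem [Finite V] (s : S) :
    ((G.addCycles S (m + 3)).neighborSet (.inl s)).ncard = (G.neighborSet (s : V)).ncard + 2 := by
  rw [neighborSet_addCycles_inl_of_mem, Set.ncard_union_eq (disjoint_image_inl_cycleVertex s _),
    Set.ncard_image_of_injective _ Sum.inl_injective,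
    Set.ncard_pair fun h => one_ne_neg_one_fin (cycleVertex_injective s h).symm]

end addCycles

/-! ### From an attached cycle to its attaching vertex. -/

theorem eq_neg_and_eq_of_isBalancedAt {V : Type*} {G : SimpleGraph V} {v a b : V}
    (hN : G.neighborSet v = {a, b}) (hab : a ≠ b) {ε σ : Sym2 V → ℤ}
    (hε : ∀ e ∈ G.edgeSet, ε e = 1 ∨ ε e = -1)
    (h₁ : G.IsBalancedAt ε v) (h₂ : G.IsBalancedAt (σ * ε) v) :
    ε s(v, a) = -ε s(v, b) ∧ σ s(v, a) = σ s(v, b) := by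
  unfold IsBalancedAt at h₁ h₂
  rw [hN, finsum_mem_pair hab] at h₁ h₂
  have hb : b ∈ G.neighborSet v := by simp [hN]
  simp only [Pi.mul_apply] at h₂
  have hx := hε s(v, b) hb
  have h3 : ε s(v, a) = -ε s(v, b) := by omega
  refine ⟨h3, ?_⟩
  rw [h3] at h₂
  -- The second balance reads `(σ(b) - σ(a)) * ε(b) = 0`, and `ε(b) = ±1` cancels.
  rcases hx with hx | hx <;> rw [hx] at h₂ <;> omega

/-- Meant for `g i` the value on the edge from `i` to `i + 1`. The attaching vertex `0` gives no
relation, so the factor `c` is collected at the other `m + 2` vertices; `-1` is the last index. -/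
theorem eq_pow_mul_of_forall_ne {m : ℕ} {g : Fin (m + 3) → ℤ} {c : ℤ}
    (h : ∀ i, i ≠ 0 → g i = c * g (i - 1)) : g (-1) = c ^ (m + 2) * g 0 := by
  have key : ∀ i : Fin (m + 3), g i = c ^ i.val * g 0 := by
    intro i
    induction i using Fin.induction with
    | zero => simp
    | succ i ih =>
      rw [h _ (Fin.succ_ne_zero i), ← Fin.coeSucc_eq_succ, add_sub_cancel_right, ih,
        Fin.coeSucc_eq_succ]
      simp [pow_succ']
      ring
  have := key (-1)
  simpa [Fin.val_neg] using this

section transfer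

variable {V : Type*} {G : SimpleGraph V} {S : Set V} {m : ℕ}
  {ε σ : Sym2 (V ⊕ S × {i : Fin (m + 3) // i.val ≠ 0}) → ℤ}

/-- Along an attached cycle of odd length, the two edges at the attaching vertex agree, if the
edges at the other vertices either all alternate or all agree. -/
theorem cycle_ends_agree (hodd : Odd (m + 3))
    (hε : ∀ e ∈ (G.addCycles S (m + 3)).edgeSet, ε e = 1 ∨ ε e = -1)
    (h : (∀ x, (G.addCycles S (m + 3)).IsBalancedAt ε (.inr x) ∧
        (G.addCycles S (m + 3)).IsBalancedAt (σ * ε) (.inr x)) ∨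
      ∀ x, (G.addCycles S (m + 3)).IsConstAt ε (.inr x) ∧
        (G.addCycles S (m + 3)).IsConstAt σ (.inr x)) (s : S) :
    ε s(.inl (s : V), cycleVertex s (-1)) = ε s(.inl (s : V), cycleVertex s 1) ∧
    σ s(.inl (s : V), cycleVertex s (-1)) = σ s(.inl (s : V), cycleVertex s 1) := by
  -- `c` is the change of `ε` at an inner vertex: `-1` if `ε` is balanced there, `1` if it is
  -- constant. As `m + 2` is even, both have trivial power.
  have step : ∃ c : ℤ, c ^ (m + 2) = 1 ∧ ∀ i : Fin (m + 3), i ≠ 0 →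
      ε s(cycleVertex s i, cycleVertex s (i + 1)) =
        c * ε s(cycleVertex s (i - 1), cycleVertex s i) ∧
      σ s(cycleVertex s i, cycleVertex s (i + 1)) =
        1 * σ s(cycleVertex s (i - 1), cycleVertex s i) := by
    rcases h with h | h
    · refine ⟨-1, Even.neg_one_pow ?_, fun i hi => ?_⟩
      · obtain ⟨k, hk⟩ := hodd
        exact ⟨k, by omega⟩
      · have hi' : i.val ≠ 0 := fun h => hi (Fin.ext h)
        have hc := cycleVertex_of_ne s ⟨i, hi'⟩
        have := eq_neg_and_eq_of_isBalancedAt (neighborSet_addCycles_inr s ⟨i, hi'⟩)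
          (fun h => sub_one_ne_add_one _ (cycleVertex_injective s h)) hε (h _).1 (h _).2
        rw [← hc] at this
        simp only at this
        rw [Sym2.eq_swap (a := cycleVertex s (i - 1))]
        constructor <;> linarith [this.1, this.2]
    · refine ⟨1, one_pow _, fun i hi => ?_⟩
      have hi' : i.val ≠ 0 := fun h => hi (Fin.ext h)
      have hc := cycleVertex_of_ne s ⟨i, hi'⟩
      have hN := neighborSet_addCycles_inr (G := G) s ⟨i, hi'⟩
      have h1 := (h (s, ⟨i, hi'⟩)).1 _ (by rw [hN]; exact Or.inl rfl) _ (by rw [hN]; exact Or.inr rfl)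
      have h2 := (h (s, ⟨i, hi'⟩)).2 _ (by rw [hN]; exact Or.inl rfl) _ (by rw [hN]; exact Or.inr rfl)
      rw [← hc] at h1 h2
      simp only at h1 h2
      rw [Sym2.eq_swap (a := cycleVertex s (i - 1)), one_mul, one_mul]
      exact ⟨h1.symm, h2.symm⟩
  obtain ⟨c, hc, hstep⟩ := step
  have e1 := eq_pow_mul_of_forall_ne
    (g := fun i => ε s(cycleVertex s i, cycleVertex s (i + 1))) (c := c)
    (fun i hi => by simpa using (hstep i hi).1)
  have e2 := eq_pow_mul_of_forall_ne
    (g := fun i => σ s(cycleVertex s i, cycleVertex s (i + 1))) (c := 1)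
    (fun i hi => by simpa using (hstep i hi).2)
  simp only [neg_add_cancel, zero_add, cycleVertex_zero, hc, one_pow, one_mul] at e1 e2
  rw [Sym2.eq_swap (a := cycleVertex s (-1))] at e1 e2
  exact ⟨e1, e2⟩

theorem IsBalancedAt.of_addCycles_of_notMem {g : Sym2 (V ⊕ S × {i : Fin (m + 3) // i.val ≠ 0}) → ℤ}
    {v : V} (hv : v ∉ S) (h : (G.addCycles S (m + 3)).IsBalancedAt g (.inl v)) :
    G.IsBalancedAt (g ∘ Sym2.map Sum.inl) v := by
  unfold IsBalancedAt at *
  rwa [neighborSet_addCycles_inl_of_notMem hv, finsum_mem_image Sum.inl_injective.injOn] at h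

theorem IsBalancedAt.addCycles_of_mem [Finite V]
    {g : Sym2 (V ⊕ S × {i : Fin (m + 3) // i.val ≠ 0}) → ℤ} (s : S)
    (h : (G.addCycles S (m + 3)).IsBalancedAt g (.inl s)) :
    (∑ᶠ a ∈ G.neighborSet s, g s(.inl (s : V), .inl a)) +
      (g s(.inl (s : V), cycleVertex s (-1)) + g s(.inl (s : V), cycleVertex s 1)) = 0 := by
  unfold IsBalancedAt at h
  rwa [neighborSet_addCycles_inl_of_mem, finsum_mem_union (disjoint_image_inl_cycleVertex s _)
    (Set.toFinite _) (Set.toFinite _), finsum_mem_image Sum.inl_injective.injOn,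
    finsum_mem_pair fun h => one_ne_neg_one_fin (cycleVertex_injective s h).symm] at h

/-- If the two cycle edges at a vertex `s` of degree two agree, then so do all edges at `s` under
`σ`, and the two old edges under `ε`. -/
theorem isConstAt_of_mem [Finite V]
    (hε : ∀ e ∈ (G.addCycles S (m + 3)).edgeSet, ε e = 1 ∨ ε e = -1)
    (hσ : ∀ e ∈ (G.addCycles S (m + 3)).edgeSet, σ e = 0 ∨ σ e = 1) (s : S)
    (hs : (G.neighborSet (s : V)).ncard = 2)
    (h₁ : (G.addCycles S (m + 3)).IsBalancedAt ε (.inl s))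
    (h₂ : (G.addCycles S (m + 3)).IsBalancedAt (σ * ε) (.inl s))
    (he : ε s(.inl (s : V), cycleVertex s (-1)) = ε s(.inl (s : V), cycleVertex s 1))
    (hs' : σ s(.inl (s : V), cycleVertex s (-1)) = σ s(.inl (s : V), cycleVertex s 1)) :
    G.IsConstAt (ε ∘ Sym2.map Sum.inl) s ∧ (G.addCycles S (m + 3)).IsConstAt σ (.inl s) := by
  obtain ⟨a, b, hab, hN⟩ := Set.ncard_eq_two.1 hs
  have b1 := h₁.addCycles_of_mem
  have b2 := h₂.addCycles_of_mem
  have hN' := neighborSet_addCycles_inl_of_mem (G := G) (m := m) s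
  rw [hN, finsum_mem_pair hab] at b1 b2
  rw [hN, Set.image_pair] at hN'
  have hmem : ∀ x ∈ ({.inl a, .inl b} ∪ {cycleVertex s (-1), cycleVertex s 1} : Set _),
      s(.inl (s : V), x) ∈ (G.addCycles S (m + 3)).edgeSet := by
    intro x hx
    rwa [mem_edgeSet, ← mem_neighborSet, hN']
  have ea := hε s(.inl (s : V), .inl a) (hmem _ (by simp))
  have eb := hε s(.inl (s : V), .inl b) (hmem _ (by simp))
  have ec := hε s(.inl (s : V), cycleVertex s 1) (hmem _ (by simp))
  have sa := hσ s(.inl (s : V), .inl a) (hmem _ (by simp))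
  have sb := hσ s(.inl (s : V), .inl b) (hmem _ (by simp))
  have sc := hσ s(.inl (s : V), cycleVertex s 1) (hmem _ (by simp))
  simp only [Pi.mul_apply] at b1 b2
  rw [he] at b1 b2
  rw [hs'] at b2
  generalize ε s(.inl (s : V), cycleVertex s 1) = xc at *
  -- The cycle edges contribute `2 * xc`, which two old edges of sign `±1` can offset only if both
  -- are `-xc`.
  have h3 : ε s(.inl (s : V), .inl a) = -xc := by omega
  have h4 : ε s(.inl (s : V), .inl b) = -xc := by omega
  -- Now `σ(a) + σ(b)` is twice the value of `σ` on a cycle edge; for values in `{0, 1}` this forces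
  -- all to agree.
  have h5 : σ s(.inl (s : V), .inl a) = σ s(.inl (s : V), cycleVertex s 1) ∧
      σ s(.inl (s : V), .inl b) = σ s(.inl (s : V), cycleVertex s 1) := by
    rw [h3, h4] at b2
    rcases ec with rfl | rfl <;> constructor <;> omega
  constructor
  · intro x hx y hy
    simp only [hN, Set.mem_insert_iff, Set.mem_singleton_iff] at hx hy
    rcases hx with rfl | rfl <;> rcases hy with rfl | rfl <;> simp [h3, h4]
  · have : ∀ x ∈ (G.addCycles S (m + 3)).neighborSet (.inl (s : V)),
        σ s(.inl (s : V), x) = σ s(.inl (s : V), cycleVertex s 1) := by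
      intro x hx
      simp only [hN', Set.mem_union, Set.mem_insert_iff, Set.mem_singleton_iff] at hx
      rcases hx with (rfl | rfl) | rfl | rfl
      exacts [h5.1, h5.2, hs', rfl]
    intro x hx y hy
    rw [this x hx, this y hy]

end transfer

/-! ### Induction over the stages of attachment. -/

instance finite_iterVertex (n r : ℕ) : Finite (IterVertex n r) := by
  induction r with
  | zero => exact inferInstanceAs (Finite (Fin n))
  | succ r ih =>
    exact inferInstanceAs (Finite (IterVertex n r ⊕
      {v | ((iterGraph n r).neighborSet v).ncard = 2} × {i : Fin n // i.val ≠ 0}))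

theorem ncard_neighborSet_cycleGraph {m : ℕ} (v : Fin (m + 3)) :
    ((cycleGraph (m + 3)).neighborSet v).ncard = 2 := by
  rw [cycleGraph_neighborSet]
  exact Set.ncard_pair (sub_one_ne_add_one v)

/-- In `G_r^n`, a subset of the edges on which the signs `ε` stay balanced contains all or none of
the edges at each vertex; `σ` is the indicator of the subset. -/
theorem isConstAt_iterGraph {m : ℕ} (hodd : Odd (m + 3)) (r : ℕ)
    (ε σ : Sym2 (IterVertex (m + 3) r) → ℤ)
    (hε : ∀ e ∈ (iterGraph (m + 3) r).edgeSet, ε e = 1 ∨ ε e = -1)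
    (hσ : ∀ e ∈ (iterGraph (m + 3) r).edgeSet, σ e = 0 ∨ σ e = 1)
    (h : ∀ v, ((iterGraph (m + 3) r).neighborSet v).ncard ≠ 2 →
      (iterGraph (m + 3) r).IsBalancedAt ε v ∧ (iterGraph (m + 3) r).IsBalancedAt (σ * ε) v)
    (h' : (∀ v, ((iterGraph (m + 3) r).neighborSet v).ncard = 2 →
      (iterGraph (m + 3) r).IsBalancedAt ε v ∧ (iterGraph (m + 3) r).IsBalancedAt (σ * ε) v) ∨
      (∀ v, ((iterGraph (m + 3) r).neighborSet v).ncard = 2 →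
      (iterGraph (m + 3) r).IsConstAt ε v ∧ (iterGraph (m + 3) r).IsConstAt σ v)) (v) :
    (iterGraph (m + 3) r).IsConstAt σ v := by
  have deg_two : ∀ v, ((iterGraph (m + 3) r).neighborSet v).ncard = 2 →
      (iterGraph (m + 3) r).IsConstAt σ v := by
    intro v hv
    rcases h' with h' | h'
    · obtain ⟨a, b, hab, hN⟩ := Set.ncard_eq_two.1 hv
      have := (eq_neg_and_eq_of_isBalancedAt hN hab hε (h' v hv).1 (h' v hv).2).2
      intro x hx y hy
      simp only [hN, Set.mem_insert_iff, Set.mem_singleton_iff] at hx hy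
      rcases hx with rfl | rfl <;> rcases hy with rfl | rfl <;> simp [this]
    · exact (h' v hv).2
  induction r with
  | zero => exact deg_two v (ncard_neighborSet_cycleGraph (m := m) v)
  | succ r ih =>
    let S : Set (IterVertex (m + 3) r) := {v | ((iterGraph (m + 3) r).neighborSet v).ncard = 2}
    change ∀ e ∈ ((iterGraph (m + 3) r).addCycles S (m + 3)).edgeSet, _ at hε
    change ∀ e ∈ ((iterGraph (m + 3) r).addCycles S (m + 3)).edgeSet, _ at hσ
    have hnew := fun x : S × {i : Fin (m + 3) // i.val ≠ 0} =>
      ncard_neighborSet_addCycles_inr (G := iterGraph (m + 3) r) x.1 x.2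
    -- Vertices of `S` now have degree four and the others keep theirs, so `h` supplies balance at
    -- every old vertex.
    have hold : ∀ u, (((iterGraph (m + 3) r).addCycles S (m + 3)).neighborSet (.inl u)).ncard ≠ 2 := by
      intro u
      by_cases hu : u ∈ S
      · rw [ncard_neighborSet_addCycles_inl_of_mem ⟨u, hu⟩]
        have : ((iterGraph (m + 3) r).neighborSet u).ncard = 2 := hu
        simp only
        omega
      · rwa [ncard_neighborSet_addCycles_inl_of_notMem hu]
    have ends := cycle_ends_agree (G := iterGraph (m + 3) r) (S := S) (σ := σ) hodd hε
      (h'.imp (fun k x => k (.inr x) (hnew x)) (fun k x => k (.inr x) (hnew x)))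
    have attach := fun s : S => isConstAt_of_mem (G := iterGraph (m + 3) r) hε hσ s s.2
      (h _ (hold s)).1 (h _ (hold s)).2 (ends s).1 (ends s).2
    have restr : ∀ e ∈ (iterGraph (m + 3) r).edgeSet,
        Sym2.map Sum.inl e ∈ ((iterGraph (m + 3) r).addCycles S (m + 3)).edgeSet := by
      intro e
      induction e with | h a b => exact id
    have restr_const : ∀ u, ((iterGraph (m + 3) r).addCycles S (m + 3)).IsConstAt σ (.inl u) →
        (iterGraph (m + 3) r).IsConstAt (σ ∘ Sym2.map Sum.inl) u :=
      fun u k a ha b hb => k (.inl a) ha (.inl b) hb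
    have hb : ∀ u, ((iterGraph (m + 3) r).neighborSet u).ncard = 2 →
        (iterGraph (m + 3) r).IsConstAt (ε ∘ Sym2.map Sum.inl) u ∧
        (iterGraph (m + 3) r).IsConstAt (σ ∘ Sym2.map Sum.inl) u :=
      fun u hu => ⟨(attach ⟨u, hu⟩).1, restr_const u (attach ⟨u, hu⟩).2⟩
    -- Removing the cycles destroys balance at the vertices of `S`, where constancy replaces it;
    -- this is why `h'` offers two alternatives. Other old vertices lose no edge and stay balanced.
    have IH := fun u => ih (ε ∘ Sym2.map Sum.inl) (σ ∘ Sym2.map Sum.inl)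
      (fun e he => hε _ (restr e he)) (fun e he => hσ _ (restr e he))
      (fun u hu => ⟨IsBalancedAt.of_addCycles_of_notMem (S := S) hu (h _ (hold u)).1,
        IsBalancedAt.of_addCycles_of_notMem (S := S) hu (h _ (hold u)).2⟩)
      (Or.inr hb) u (fun u hu => (hb u hu).2)
    rcases v with u | x
    · by_cases hu : u ∈ S
      · exact (attach ⟨u, hu⟩).2
      · intro a ha b hb'
        change a ∈ ((iterGraph (m + 3) r).addCycles S (m + 3)).neighborSet (.inl u) at ha
        change b ∈ ((iterGraph (m + 3) r).addCycles S (m + 3)).neighborSet (.inl u) at hb'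
        rw [neighborSet_addCycles_inl_of_notMem hu] at ha hb'
        obtain ⟨a, ha, rfl⟩ := ha
        obtain ⟨b, hb', rfl⟩ := hb'
        exact IH u a ha b hb'
    · exact deg_two _ (hnew x)

end SimpleGraph

/-! ### Counting edges. -/

namespace SimpleGraph

theorem sum_ncard_neighborSet {V : Type*} [Fintype V] (G : SimpleGraph V) :
    ∑ v, (G.neighborSet v).ncard = 2 * Nat.card G.edgeSet := by
  classical
  rw [Nat.card_eq_fintype_card, ← edgeFinset_card, ← sum_degrees_eq_twice_card_edges]
  refine Finset.sum_congr rfl fun v _ => ?_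
  rw [Set.ncard_eq_toFinset_card', ← card_neighborFinset_eq_degree]
  rfl

theorem card_fin_ne_zero (m : ℕ) : Nat.card {i : Fin (m + 3) // i.val ≠ 0} = m + 2 := by
  have : ∀ i : Fin (m + 3), i.val ≠ 0 ↔ ¬ i = 0 := fun i => (Fin.val_ne_zero_iff (a := i))
  rw [Nat.card_congr (Equiv.subtypeEquivRight this), Nat.card_eq_fintype_card,
    Fintype.card_subtype_compl]
  simp

/-- By the handshake lemma: for each `s ∈ S` the degree of `s` grows by 2 and `m + 2` vertices of
degree 2 appear. -/
theorem card_edgeSet_addCycles {V : Type*} [Finite V] (G : SimpleGraph V) (S : Set V) (m : ℕ) :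
    Nat.card (G.addCycles S (m + 3)).edgeSet = Nat.card G.edgeSet + (m + 3) * Nat.card S := by
  classical
  have := Fintype.ofFinite V
  have h := sum_ncard_neighborSet (G.addCycles S (m + 3))
  have h1 : ∀ v, ((G.addCycles S (m + 3)).neighborSet (.inl v)).ncard =
      (G.neighborSet v).ncard + if v ∈ S then 2 else 0 := by
    intro v
    split_ifs with hv
    · exact ncard_neighborSet_addCycles_inl_of_mem ⟨v, hv⟩
    · exact ncard_neighborSet_addCycles_inl_of_notMem hv
  have h2 : ∀ x : S × {i : Fin (m + 3) // i.val ≠ 0},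
      ((G.addCycles S (m + 3)).neighborSet (.inr x)).ncard = 2 :=
    fun x => ncard_neighborSet_addCycles_inr x.1 x.2
  have h3 : ∑ v, (if v ∈ S then 2 else 0) = 2 * Nat.card S := by
    rw [← Finset.sum_filter, Finset.sum_const, Nat.card_eq_fintype_card, Fintype.card_subtype,
      smul_eq_mul, mul_comm]
  have h4 := card_fin_ne_zero m
  rw [Nat.card_eq_fintype_card] at h4
  rw [Fintype.sum_sum_type, Finset.sum_congr rfl fun v _ => h1 v,
    Finset.sum_congr rfl fun v _ => h2 v, Finset.sum_add_distrib, sum_ncard_neighborSet, h3,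
    Finset.sum_const, Finset.card_univ, Fintype.card_prod, h4, ← Nat.card_eq_fintype_card,
    smul_eq_mul] at h
  linarith

/-- The vertices of degree two at a later stage are exactly the new ones, `m + 2` for each attached
cycle. -/
theorem card_degree_two_iterGraph (m r : ℕ) :
    Nat.card {v | ((iterGraph (m + 3) r).neighborSet v).ncard = 2} = (m + 3) * (m + 2) ^ r := by
  induction r with
  | zero =>
    have : {v | ((iterGraph (m + 3) 0).neighborSet v).ncard = 2} = Set.univ :=
      Set.eq_univ_of_forall fun v => ncard_neighborSet_cycleGraph (m := m) v
    rw [this, Nat.card_univ, pow_zero, mul_one]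
    exact Nat.card_fin _
  | succ r ih =>
    let S : Set (IterVertex (m + 3) r) := {v | ((iterGraph (m + 3) r).neighborSet v).ncard = 2}
    change Nat.card {v | (((iterGraph (m + 3) r).addCycles S (m + 3)).neighborSet v).ncard = 2} = _
    have : {v | (((iterGraph (m + 3) r).addCycles S (m + 3)).neighborSet v).ncard = 2} =
        Set.range Sum.inr := by
      ext (u | x)
      · simp only [Set.mem_ofPred_eq, Set.mem_range, reduceCtorEq, exists_false, iff_false]
        by_cases hu : u ∈ S
        · have : ((iterGraph (m + 3) r).neighborSet u).ncard = 2 := hu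
          have := ncard_neighborSet_addCycles_inl_of_mem (G := iterGraph (m + 3) r) (m := m) ⟨u, hu⟩
          simp only at this
          omega
        · rwa [ncard_neighborSet_addCycles_inl_of_notMem hu]
      · simpa using ncard_neighborSet_addCycles_inr x.1 x.2
    rw [this, Nat.card_range_of_injective Sum.inr_injective, Nat.card_prod, ih, card_fin_ne_zero]
    ring

theorem card_edgeSet_iterGraph_succ (m r : ℕ) :
    Nat.card (iterGraph (m + 3) (r + 1)).edgeSet =
      Nat.card (iterGraph (m + 3) r).edgeSet + (m + 3) * ((m + 3) * (m + 2) ^ r) := by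
  rw [← card_degree_two_iterGraph]
  exact card_edgeSet_addCycles _ _ _

theorem card_edgeSet_iterGraph_zero (m : ℕ) :
    Nat.card (iterGraph (m + 3) 0).edgeSet = m + 3 := by
  have h := sum_ncard_neighborSet (cycleGraph (m + 3))
  rw [Finset.sum_congr rfl fun v _ => ncard_neighborSet_cycleGraph v] at h
  simp only [Finset.sum_const, Finset.card_univ, Fintype.card_fin, smul_eq_mul] at h
  change Nat.card (cycleGraph (m + 3)).edgeSet = _
  linarith

/-- Stage 0 has `n` edges, an odd number, and the first attachment adds the odd number `n²`. Every
later one adds a multiple of the even number `n - 1`. -/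
theorem even_card_edgeSet_iterGraph {m : ℕ} (hodd : Odd (m + 3)) (r : ℕ) :
    Even (Nat.card (iterGraph (m + 3) (r + 1)).edgeSet) := by
  have h2 : Even (m + 2) := by
    obtain ⟨k, hk⟩ := hodd
    exact ⟨k, by omega⟩
  induction r with
  | zero =>
    rw [card_edgeSet_iterGraph_succ, card_edgeSet_iterGraph_zero, pow_zero, mul_one]
    exact hodd.add_odd (hodd.mul hodd)
  | succ r ih =>
    rw [card_edgeSet_iterGraph_succ]
    exact ih.add (((h2.pow_of_ne_zero (Nat.succ_ne_zero r)).mul_left _).mul_left _)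

theorem card_edgeSet_iterGraph (m r : ℕ) :
    (Nat.card (iterGraph (m + 3) r).edgeSet : ℚ) =
      (m + 3) + (m + 3) ^ 2 * (((m + 2) ^ r - 1) / (m + 1)) := by
  induction r with
  | zero =>
    rw [card_edgeSet_iterGraph_zero]
    simp
  | succ r ih =>
    have : (m : ℚ) + 1 ≠ 0 := by positivity
    rw [card_edgeSet_iterGraph_succ]
    push_cast
    rw [ih]
    field_simp
    ring

end SimpleGraph

/-! ### Binomials of a toric ideal and degrees. -/

open MvPolynomial in
theorem toricDegree_eq_of_sub_mem_toricIdeal {K : Type*} [Field K] {σ M : Type*} [AddCommMonoid M]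
    {a : σ → M} {u v : σ →₀ ℕ} (h : monom K u - monom K v ∈ toricIdeal K a) :
    toricDegree a u = toricDegree a v := by
  -- Sending each variable to its degree in the monoid algebra kills the generators, and distinct
  -- degrees stay distinct there.
  let φ : MvPolynomial σ K →ₐ[K] AddMonoidAlgebra K M :=
    aeval fun i => AddMonoidAlgebra.single (a i) 1
  have hφ : ∀ u : σ →₀ ℕ, φ (monom K u) = AddMonoidAlgebra.single (toricDegree a u) 1 := by
    intro u
    induction u using Finsupp.induction_linear with
    | zero =>
      have : monom K (0 : σ →₀ ℕ) = 1 := by rw [monom, monomial_zero', C_1]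
      rw [this, map_one]
      simp [toricDegree, AddMonoidAlgebra.one_def]
    | add u v hu hv =>
      have : monom K (u + v) = monom K u * monom K v := by simp [monom, monomial_mul]
      rw [this, map_mul, hu, hv, AddMonoidAlgebra.single_mul_single, mul_one]
      congr 1
      exact (Finsupp.sum_add_index' (by simp) (by simp [add_smul])).symm
    | single i k =>
      have : monom K (Finsupp.single i k) = X i ^ k := by rw [X_pow_eq_monomial]
      rw [this, map_pow]
      simp [φ, toricDegree, AddMonoidAlgebra.single_pow]
  have hle : toricIdeal K a ≤ RingHom.ker φ := by
    refine Ideal.span_le.2 ?_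
    rintro _ ⟨u, v, huv, rfl⟩
    simp [RingHom.mem_ker, hφ, huv]
  have := hle h
  rw [RingHom.mem_ker, map_sub, hφ, hφ, sub_eq_zero] at this
  exact Multiplicative.ofAdd.injective (AddMonoidAlgebra.of_injective (R := K) this)

theorem toricDegree_add {σ M : Type*} [AddCommMonoid M] (a : σ → M) (u v : σ →₀ ℕ) :
    toricDegree a (u + v) = toricDegree a u + toricDegree a v :=
  Finsupp.sum_add_index' (by simp) (by simp [add_smul])

theorem toricDegree_sum_single {ι σ M : Type*} [AddCommMonoid M] (a : σ → M) (s : Finset ι)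
    (f : ι → σ) : toricDegree a (∑ k ∈ s, Finsupp.single (f k) 1) = ∑ k ∈ s, a (f k) := by
  classical
  induction s using Finset.induction_on with
  | empty => simp [toricDegree]
  | insert i s hi ih =>
    rw [Finset.sum_insert hi, Finset.sum_insert hi, toricDegree_add, ih]
    simp [toricDegree]

/-! ### Exponent vectors as functions on edges. -/

namespace SimpleGraph

open Classical in
/-- The multiplicities of the edges in `u`, extended by zero to all pairs of vertices. -/
noncomputable def multiplicity {V : Type*} {G : SimpleGraph V} (u : G.edgeSet →₀ ℕ) (e : Sym2 V) :
    ℤ :=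
  if h : e ∈ G.edgeSet then (u ⟨e, h⟩ : ℤ) else 0

theorem multiplicity_of_mem {V : Type*} {G : SimpleGraph V} (u : G.edgeSet →₀ ℕ) {e : Sym2 V}
    (h : e ∈ G.edgeSet) : multiplicity u e = u ⟨e, h⟩ := dif_pos h

/-- Both sides are additive in `u`, and a single edge contributes only at its two ends. -/
theorem toricDegree_edgeVector_apply {V : Type*} [Finite V] {G : SimpleGraph V}
    (u : G.edgeSet →₀ ℕ) (x : V) :
    toricDegree G.edgeVector u x = ∑ᶠ y ∈ G.neighborSet x, multiplicity u s(x, y) := by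
  classical
  have := Fintype.ofFinite V
  rw [finsum_mem_eq_toFinset_sum]
  induction u using Finsupp.induction_linear with
  | zero => simp [toricDegree, multiplicity]
  | add u v hu hv =>
    rw [toricDegree_add, Finsupp.add_apply, hu, hv, ← Finset.sum_add_distrib]
    refine Finset.sum_congr rfl fun y _ => ?_
    unfold multiplicity
    split_ifs <;> simp
  | single e k =>
    obtain ⟨e, he⟩ := e
    induction e with | h a b =>
    have hval : ∀ y ∈ (G.neighborSet x).toFinset,
        multiplicity (Finsupp.single (⟨s(a, b), he⟩ : G.edgeSet) k) s(x, y) =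
          if s(a, b) = s(x, y) then (k : ℤ) else 0 := by
      intro y hy
      rw [multiplicity_of_mem _ (by simpa using hy), Finsupp.single_apply]
      simp only [Subtype.mk.injEq]
      split_ifs <;> simp
    rw [Finset.sum_congr rfl hval]
    have hab : a ≠ b := G.ne_of_adj he
    simp only [toricDegree, zero_smul, Finsupp.sum_single_index, edgeVector, Sym2.lift_mk,
      Finsupp.smul_apply, Finsupp.add_apply, Finsupp.single_apply]
    by_cases ha : a = x
    · subst ha
      rw [Finset.sum_eq_single_of_mem b (by simpa using he)
        (fun y _ hy => if_neg (by simp [hab.symm, hy.symm]))]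
      simp [hab.symm]
    by_cases hb : b = x
    · subst hb
      rw [Finset.sum_eq_single_of_mem a (by simpa using G.adj_symm he)
        (fun y _ hy => by simp [hab, hy.symm])]
      simp [hab]
    · rw [Finset.sum_eq_zero fun y _ => by simp [ha, hb]]
      simp [ha, hb]

theorem isBalancedAt_multiplicity_sub {V : Type*} [Finite V] {G : SimpleGraph V}
    {u v : G.edgeSet →₀ ℕ} (h : toricDegree G.edgeVector u = toricDegree G.edgeVector v) (x : V) :
    G.IsBalancedAt (multiplicity u - multiplicity v) x := by
  have h := DFunLike.congr_fun h x
  rw [toricDegree_edgeVector_apply, toricDegree_edgeVector_apply, ← sub_eq_zero] at h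
  exact (finsum_mem_sub_distrib _ _ (Set.toFinite _)).trans h

/-! ### Binomials of closed Eulerian walks. -/

namespace Walk

variable {V : Type*} {G : SimpleGraph V} {x y : V}

/-- The exponent of the monomial `E⁺(w)`. -/
noncomputable def posExponent (w : G.Walk x y) : G.edgeSet →₀ ℕ :=
  ∑ k : Fin (w.length / 2), Finsupp.single (w.edgeAt (2 * k) (by omega)) 1

/-- The exponent of the monomial `E⁻(w)`. -/
noncomputable def negExponent (w : G.Walk x y) : G.edgeSet →₀ ℕ :=
  ∑ k : Fin (w.length / 2), Finsupp.single (w.edgeAt (2 * k + 1) (by omega)) 1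

theorem evenWalkPos_eq (K : Type*) [Field K] (w : G.Walk x y) :
    w.evenWalkPos K = monom K w.posExponent :=
  (MvPolynomial.monomial_sum_one _ _).symm

theorem evenWalkNeg_eq (K : Type*) [Field K] (w : G.Walk x y) :
    w.evenWalkNeg K = monom K w.negExponent :=
  (MvPolynomial.monomial_sum_one _ _).symm

theorem edgeVector_edgeAt (w : G.Walk x y) {i : ℕ} (hi : i < w.length) :
    G.edgeVector (w.edgeAt i hi) =
      Finsupp.single (w.getVert i) 1 + Finsupp.single (w.getVert (i + 1)) 1 := rfl

/-- In each pair of consecutive edges the shared vertex cancels; what remains telescopes over the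
even positions from `x` back to `x`. -/
theorem toricDegree_posExponent (w : G.Walk x x) (hw : Even w.length) :
    toricDegree G.edgeVector w.posExponent = toricDegree G.edgeVector w.negExponent := by
  unfold posExponent negExponent
  rw [toricDegree_sum_single, toricDegree_sum_single, ← sub_eq_zero, ← Finset.sum_sub_distrib]
  simp only [edgeVector_edgeAt]
  rw [Fin.sum_univ_eq_sum_range (fun k => (Finsupp.single (w.getVert (2 * k)) (1 : ℤ) +
    Finsupp.single (w.getVert (2 * k + 1)) 1 -
    (Finsupp.single (w.getVert (2 * k + 1)) 1 + Finsupp.single (w.getVert (2 * k + 1 + 1)) 1)))]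
  have : ∀ k, (Finsupp.single (w.getVert (2 * k)) (1 : ℤ) +
      Finsupp.single (w.getVert (2 * k + 1)) 1 -
      (Finsupp.single (w.getVert (2 * k + 1)) 1 + Finsupp.single (w.getVert (2 * k + 1 + 1)) 1)) =
      Finsupp.single (w.getVert (2 * k)) (1 : ℤ) - Finsupp.single (w.getVert (2 * (k + 1))) 1 := by
    intro k
    rw [mul_add, mul_one]
    abel
  simp only [this]
  rw [Finset.sum_range_sub' (fun k => Finsupp.single (w.getVert (2 * k)) (1 : ℤ)),
    Nat.two_mul_div_two_of_even hw]
  simp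

section Eulerian

variable [DecidableEq V] {w : G.Walk x y}

theorem IsEulerian.edgeAt_inj (hw : w.IsEulerian) {i j : ℕ} (hi : i < w.length) (hj : j < w.length) :
    w.edgeAt i hi = w.edgeAt j hj ↔ i = j := by
  have hn : w.edges.Nodup := hw.isTrail.edges_nodup
  rw [← hn.getElem_inj_iff (hi := by simpa using hi) (hj := by simpa using hj), getElem_edges,
    getElem_edges]
  exact Subtype.ext_iff

theorem IsEulerian.exists_edgeAt (hw : w.IsEulerian) (e : G.edgeSet) :
    ∃ i, ∃ hi : i < w.length, w.edgeAt i hi = e := by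
  obtain ⟨i, hi, h⟩ := List.mem_iff_getElem.1 (hw.mem_edges_iff.2 e.2)
  rw [getElem_edges] at h
  exact ⟨i, by simpa using hi, Subtype.ext h⟩

theorem IsEulerian.length_eq (hw : w.IsEulerian) : w.length = Nat.card G.edgeSet := by
  rw [← Nat.card_fin w.length]
  refine Nat.card_eq_of_bijective (fun i : Fin w.length => w.edgeAt i i.2) ⟨?_, ?_⟩
  · intro i j h
    exact Fin.ext ((hw.edgeAt_inj _ _).1 h)
  · intro e
    obtain ⟨i, hi, h⟩ := hw.exists_edgeAt e
    exact ⟨⟨i, hi⟩, h⟩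

theorem IsEulerian.posExponent_edgeAt (hw : w.IsEulerian) (heven : Even w.length)
    {i : ℕ} (hi : i < w.length) :
    w.posExponent (w.edgeAt i hi) = if Even i then 1 else 0 := by
  unfold posExponent
  simp only [Finsupp.finsetSum_apply, Finsupp.single_apply, hw.edgeAt_inj]
  split_ifs with h
  · obtain ⟨k, rfl⟩ := h
    obtain ⟨l, hl⟩ := heven
    rw [Finset.sum_eq_single_of_mem (⟨k, by omega⟩ : Fin (w.length / 2)) (Finset.mem_univ _)]
    · simp [two_mul]
    · intro b _ hb
      rw [if_neg]
      intro h
      exact hb (Fin.ext (by simp only; omega))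
  · refine Finset.sum_eq_zero fun k _ => if_neg ?_
    rintro rfl
    exact h (even_two_mul _)

theorem IsEulerian.negExponent_edgeAt (hw : w.IsEulerian) {i : ℕ} (hi : i < w.length) :
    w.negExponent (w.edgeAt i hi) = if Even i then 0 else 1 := by
  unfold negExponent
  simp only [Finsupp.finsetSum_apply, Finsupp.single_apply, hw.edgeAt_inj]
  split_ifs with h
  · refine Finset.sum_eq_zero fun k _ => if_neg ?_
    rintro rfl
    simp at h
  · rw [Nat.not_even_iff_odd] at h
    obtain ⟨k, rfl⟩ := h
    rw [Finset.sum_eq_single_of_mem (⟨k, by omega⟩ : Fin (w.length / 2)) (Finset.mem_univ _)]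
    · simp
    · intro b _ hb
      rw [if_neg]
      intro h
      exact hb (Fin.ext (by simp only; omega))

theorem IsEulerian.exponents (hw : w.IsEulerian) (heven : Even w.length) (e : G.edgeSet) :
    (w.posExponent e = 1 ∧ w.negExponent e = 0) ∨ (w.posExponent e = 0 ∧ w.negExponent e = 1) := by
  obtain ⟨i, hi, rfl⟩ := hw.exists_edgeAt e
  rw [hw.posExponent_edgeAt heven, hw.negExponent_edgeAt]
  split_ifs <;> simp

theorem IsEulerian.posExponent_ne (hw : w.IsEulerian) (heven : Even w.length) (hpos : 0 < w.length) :
    w.posExponent ≠ w.negExponent := by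
  intro h
  rcases hw.exponents heven (w.edgeAt 0 hpos) with h' | h' <;> rw [h] at h' <;> omega

/-- Consecutive edges of the walk share a vertex, and the walk meets every edge. -/
theorem IsEulerian.eq_of_isConstAt (hw : w.IsEulerian) {g : Sym2 V → ℤ}
    (hg : ∀ v, G.IsConstAt g v) (e f : G.edgeSet) : g e = g f := by
  have key : ∀ i (hi : i < w.length), g (w.edgeAt i hi) = g (w.edgeAt 0 (by omega)) := by
    intro i
    induction i with
    | zero => intro _; rfl
    | succ i ih =>
      intro hi
      rw [← ih (by omega)]
      have h1 := w.adj_getVert_succ hi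
      have h0 := (w.adj_getVert_succ (i := i) (by omega)).symm
      have := hg _ _ h1 _ h0
      rwa [Sym2.eq_swap (b := w.getVert i)] at this
  obtain ⟨i, hi, rfl⟩ := hw.exists_edgeAt e
  obtain ⟨j, hj, rfl⟩ := hw.exists_edgeAt f
  rw [key i hi, key j hj]

end Eulerian

theorem monom_sub_ne_zero {K : Type*} [Field K] {σ : Type*} {u v : σ →₀ ℕ} :
    monom K u - monom K v ≠ 0 ↔ u ≠ v := by
  rw [sub_ne_zero, Ne, MvPolynomial.monomial_left_inj one_ne_zero]

theorem IsEulerian.binomial_ne_zero (K : Type*) [Field K] [DecidableEq V] {w : G.Walk x x}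
    (hw : w.IsEulerian) (heven : Even w.length) (hpos : 0 < w.length) : w.binomial K ≠ 0 := by
  rw [Walk.binomial, evenWalkPos_eq, evenWalkNeg_eq, monom_sub_ne_zero]
  exact hw.posExponent_ne heven hpos

/-- An Eulerian closed walk of even length gives a primitive binomial if every subset of the edges
with balanced signs contains all or none of the edges at each vertex. -/
theorem IsEulerian.isPrimitiveBinomial (K : Type*) [Field K] [Finite V] [DecidableEq V]
    {w : G.Walk x x} (hw : w.IsEulerian) (heven : Even w.length) (hpos : 0 < w.length)
    (H : ∀ ε σ : Sym2 V → ℤ, (∀ e ∈ G.edgeSet, ε e = 1 ∨ ε e = -1) →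
      (∀ e ∈ G.edgeSet, σ e = 0 ∨ σ e = 1) →
      (∀ v, G.IsBalancedAt ε v ∧ G.IsBalancedAt (σ * ε) v) → ∀ v, G.IsConstAt σ v) :
    IsPrimitiveBinomial (toricIdeal K G.edgeVector) (w.binomial K) := by
  refine ⟨w.posExponent, w.negExponent, ?_, hw.binomial_ne_zero K heven hpos, ?_, ?_⟩
  · rw [Walk.binomial, evenWalkPos_eq, evenWalkNeg_eq]
  · rw [Walk.binomial, evenWalkPos_eq, evenWalkNeg_eq]
    exact Ideal.subset_span ⟨_, _, w.toricDegree_posExponent heven, rfl⟩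
  intro p q hmem hne hp hq
  rw [monom_sub_ne_zero] at hne
  have hp : p ≤ w.posExponent := by
    simpa [MvPolynomial.monomial_dvd_monomial] using hp
  have hq : q ≤ w.negExponent := by
    simpa [MvPolynomial.monomial_dvd_monomial] using hq
  have hdeg := toricDegree_eq_of_sub_mem_toricIdeal hmem
  have hcases : ∀ e : G.edgeSet,
      (w.posExponent e = 1 ∧ w.negExponent e = 0 ∧ p e ≤ 1 ∧ q e = 0) ∨
      (w.posExponent e = 0 ∧ w.negExponent e = 1 ∧ p e = 0 ∧ q e ≤ 1) := by
    intro e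
    have := hp e
    have := hq e
    rcases hw.exponents heven e with h | h <;> omega
  -- `ε` is the alternating sign along the walk, `σ` the indicator of the edges in `x^p` or `x^q`.
  -- The two monomials of `B_w` have disjoint supports and are squarefree, whence `σ * ε = p - q`.
  let ε := multiplicity w.posExponent - multiplicity w.negExponent
  let σ := multiplicity p + multiplicity q
  have hσε : σ * ε = multiplicity p - multiplicity q := by
    funext e
    by_cases he : e ∈ G.edgeSet
    · simp only [σ, ε, Pi.mul_apply, Pi.add_apply, Pi.sub_apply, multiplicity_of_mem _ he]
      rcases hcases ⟨e, he⟩ with ⟨h1, h2, h3, h4⟩ | ⟨h1, h2, h3, h4⟩ <;> simp [*]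
    · simp [σ, ε, multiplicity, he]
  have hconst := H ε σ
    (by
      intro e he
      simp only [ε, Pi.sub_apply, multiplicity_of_mem _ he]
      rcases hcases ⟨e, he⟩ with ⟨h1, h2, h3, h4⟩ | ⟨h1, h2, h3, h4⟩ <;> simp [*])
    (by
      intro e he
      simp only [σ, Pi.add_apply, multiplicity_of_mem _ he]
      have := hcases ⟨e, he⟩
      omega)
    (fun v => ⟨isBalancedAt_multiplicity_sub (w.toricDegree_posExponent heven) v,
      hσε ▸ isBalancedAt_multiplicity_sub hdeg v⟩)
  have heq : ∀ e : G.edgeSet, p e + q e = p (w.edgeAt 0 hpos) + q (w.edgeAt 0 hpos) := by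
    intro e
    have := hw.eq_of_isConstAt hconst e (w.edgeAt 0 hpos)
    simp only [σ, Pi.add_apply, multiplicity_of_mem _ e.2,
      multiplicity_of_mem _ (w.edgeAt 0 hpos).2] at this
    exact_mod_cast this
  have h01 : p (w.edgeAt 0 hpos) + q (w.edgeAt 0 hpos) = 0 ∨
      p (w.edgeAt 0 hpos) + q (w.edgeAt 0 hpos) = 1 := by
    have := hcases (w.edgeAt 0 hpos)
    omega
  -- Constant value 0 makes `p = q = 0`, contradicting `hne`; value 1 makes `x^p` and `x^q` the full
  -- monomials of `B_w`.
  rcases h01 with h | h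
  · refine absurd ?_ hne
    ext e
    have := heq e
    omega
  · have hp' : p = w.posExponent := by
      ext e
      have := heq e
      have := hcases e
      omega
    have hq' : q = w.negExponent := by
      ext e
      have := heq e
      have := hcases e
      omega
    rw [Walk.binomial, evenWalkPos_eq, evenWalkNeg_eq, hp', hq']

theorem isHomogeneous_binomial (K : Type*) [Field K] (w : G.Walk x x) :
    (w.binomial K).IsHomogeneous (w.length / 2) := by
  have key : ∀ f : Fin (w.length / 2) → G.edgeSet,
      (∏ k, (MvPolynomial.X (f k) : MvPolynomial G.edgeSet K)).IsHomogeneous (w.length / 2) := by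
    intro f
    simpa using MvPolynomial.IsHomogeneous.prod Finset.univ
      (fun k => (MvPolynomial.X (f k) : MvPolynomial G.edgeSet K)) (fun _ => 1)
      (fun k _ => MvPolynomial.isHomogeneous_X K (f k))
  exact (key _).sub (key _)

end Walk

end SimpleGraph

/-! ### The theorem for the iterated graph. -/

open SimpleGraph in
theorem proposition4p1 (K : Type*) [Field K] (n r : ℕ) (hn : 3 ≤ n) (hodd : Odd n) (hr : 1 ≤ r)
    [DecidableEq (SimpleGraph.IterVertex n r)] (v : SimpleGraph.IterVertex n r)
    (w : (SimpleGraph.iterGraph n r).Walk v v) (hw : w.IsEulerian) :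
    Even w.length ∧
    IsPrimitiveBinomial (toricIdeal K (SimpleGraph.iterGraph n r).edgeVector) (w.binomial K) ∧
    w.binomial K ∈ graverBasis K (SimpleGraph.iterGraph n r).edgeVector ∧
    ((w.binomial K).totalDegree : ℚ) =
      1 / 2 * ((n : ℚ) + (n : ℚ) ^ 2 * ((((n : ℚ) - 1) ^ r - 1) / ((n : ℚ) - 2))) := by
  obtain ⟨m, rfl⟩ := Nat.exists_eq_add_of_le' hn
  obtain ⟨r, rfl⟩ := Nat.exists_eq_add_of_le' hr
  have hlen := hw.length_eq
  have heven : Even w.length := hlen ▸ even_card_edgeSet_iterGraph hodd r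
  have hpos : 0 < w.length := by
    rw [hlen, card_edgeSet_iterGraph_succ]
    positivity
  have hprim : IsPrimitiveBinomial (toricIdeal K (iterGraph (m + 3) (r + 1)).edgeVector)
      (w.binomial K) :=
    hw.isPrimitiveBinomial K heven hpos fun ε σ hε hσ h =>
      isConstAt_iterGraph hodd (r + 1) ε σ hε hσ (fun v _ => h v) (Or.inl fun v _ => h v)
  refine ⟨heven, hprim, hprim, ?_⟩
  rw [(w.isHomogeneous_binomial K).totalDegree (hw.binomial_ne_zero K heven hpos),
    Nat.cast_div heven.two_dvd (by norm_num), hlen, card_edgeSet_iterGraph]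
  push_cast
  have h1 : (m : ℚ) + 3 - 1 = m + 2 := by ring
  have h2 : (m : ℚ) + 3 - 2 = m + 1 := by ring
  rw [h1, h2]
  ring
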